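/- Let $k$ be a field. Let $Q$ be a (possibly infinite) quiver with vertex set $Q_0$ and arrow set $Q_1$, and let $\mathcal P=(\mathcal P_\alpha)_{\alpha\in Q_1}$ be a family of (possibly empty) linearly ordered sets. The path category $\mathcal C$ of the thread quiver $(Q,\mathcal P)$ is the $k$-linear category whose objects are the elements of $Q_0\sqcup\bigsqcup_{\alpha\in Q_1}\mathcal P_\alpha$. For an object $x$ put $e(x)=f(x)=x$ if $x\in Q_0$, and $e(x)=s(\alpha)$, $f(x)=t(\alpha)$ if $x\in\mathcal P_\alpha$. A basis of $\operatorname{Hom}_{\mathcal C}(x,y)$ is given by one element $[p]_{y,x}$ for each path $p$ of $Q$ from $f(x)$ to $e(y)$ together with, if $x\le y$ lie in the same $\mathcal P_\alpha$, one further element $\eta_{y,x}$. Composition is bilinear and is given on basis elements by $\eta_{z,y}\eta_{y,x}=\eta_{z,x}$, by $\eta_{z,y}[p]_{y,x}=[p]_{z,x}$ and $[q]_{z,y}\eta_{y,x}=[q]_{z,x}$, and by $[q]_{z,y}[p]_{y,x}=[q\,p]_{z,x}$ if $y\in Q_0$ and $[q]_{z,y}[p]_{y,x}=[q\,\alpha\,p]_{z,x}$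 if $y\in\mathcal P_\alpha$ (paths are composed from right to left). Let $\mathcal I$ be any two-sided ideal of $\mathcal C$ and $\mathcal A=\mathcal C/\mathcal I$. A pointwise finite-dimensional (pwf) representation of $\mathcal A$ is a covariant $k$-linear functor from $\mathcal A$ to the category of finite-dimensional $k$-vector spaces; direct sums of representations are formed pointwise. A pwf representation is called noise if it vanishes at every vertex in $Q_0$, and noise free if it has no nonzero noise direct summand. Let $M$ be a pwf representation of $\mathcal A$. Then there is a decomposition $$M\;\cong\;\Big(\bigoplus_{\lambda\in\Lambda} Z_\lambda\Big)\oplus\Big(\bigoplus_{\alpha\in Q_1}\bigoplus_{\eta\in H_\alpha}V_{\alpha,\eta}\Big)\qquad(*)$$ in which every $Z_\lambda$ is an indecomposable noise free pwf representation and every $V_{\alpha,\eta}$ is an indecomposable noise pwf representation whose support is contained in $\mathcal P_\alpha$. Moreover: 1. In every decomposition $(*)$ of this kind, each summand $Z_\lambda$ and $V_{\alpha,\eta}$ has a local endomorphism ring. 2. The decomposition is unique up to isomorphism: given a second decomposition of $M$ of the same kind, with summands $Z'_{\lambda}$ $(\lambda\in\Lambda')$ and $V'_{\alpha,\eta}$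 $(\eta\in H'_\alpha)$, there are a bijection $\sigma:\Lambda\to\Lambda'$ with $Z_\lambda\cong Z'_{\sigma(\lambda)}$ for all $\lambda\in\Lambda$ and, for each $\alpha\in Q_1$, a bijection $\sigma_\alpha:H_\alpha\to H'_\alpha$ with $V_{\alpha,\eta}\cong V'_{\alpha,\sigma_\alpha(\eta)}$ for all $\eta\in H_\alpha$. 3. If $Q$ is finite (that is, $Q_0$ and $Q_1$ are finite), then $\Lambda$ is finite in every decomposition $(*)$ of this kind. -/

import Mathlib

open CategoryTheory CategoryTheory.Limits
open scoped DirectSum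

universe u v w κ m ℓ ℓ'

namespace ThreadQuiver

section PathCategory

variable {Q : Type u} [Quiver.{v} Q]

/-- The objects of the path category of the thread quiver `(Q, P)`: the vertices of `Q`, and the
elements of the sets `P α`, one for each arrow `α` of `Q`. The endpoints of the extended linear
order `P̄ α = {min} ∪ P α ∪ {max}` are identified with the source and the target of `α`. -/
inductive Obj (P : Quiver.Total Q → Type w) : Type (max u v w)
  | vertex (a : Q) : Obj P
  | thread (α : Quiver.Total Q) (x : P α) : Obj P

variable {P : Quiver.Total Q → Type w}

/-- The vertex through which one enters: `a` for a vertex `a`, and `s(α)` for an element of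
`P α`. -/
def Obj.entry : Obj P → Q
  | .vertex a => a
  | .thread α _ => α.left

/-- The vertex through which one leaves: `a` for a vertex `a`, and `t(α)` for an element of
`P α`. -/
def Obj.exit : Obj P → Q
  | .vertex a => a
  | .thread α _ => α.right

/-- The path of `Q` from the entry vertex of an object to its exit vertex: the trivial path at a
vertex, and the arrow `α` at an element `x` of `P α`. It records the relation
`η_{t(α), x} η_{x, s(α)} = α`. -/
def Obj.mid : (X : Obj P) → Quiver.Path X.entry X.exit
  | .vertex _ => Quiver.Path.nil
  | .thread α _ => α.hom.toPath

variable [∀ α, LinearOrder (P α)]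

/-- The path-like elements from `X` to `Y`, which form the basis of `Hom(X, Y)`:
* `through p` stands for `η_{Y, s(β)} p η_{t(α), X}`, where `p` is a path in `Q` (the outer factors
  are absent when `X`, respectively `Y`, is a vertex, so that for two vertices these are the paths
  in `Q`);
* `within h` stands for `η_{y, x}`, where `x ≤ y` lie in the same `P α`. -/
inductive PathLike : Obj P → Obj P → Type (max u v w)
  | through {X Y : Obj P} (p : Quiver.Path X.exit Y.entry) : PathLike X Y
  | within {α : Quiver.Total Q} {x y : P α} (h : x ≤ y) :
      PathLike (Obj.thread α x) (Obj.thread α y)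

namespace PathLike

/-- The trivial path-like element at an object. -/
def id : (X : Obj P) → PathLike X X
  | .vertex _ => through Quiver.Path.nil
  | .thread _ x => within (le_refl x)

/-- Composition (in diagrammatic order) of path-like elements: concatenation of paths, together
with `η_{z, y} η_{y, x} = η_{z, x}`. -/
def comp : {X Y Z : Obj P} → PathLike X Y → PathLike Y Z → PathLike X Z
  | _, Y, _, through p, through q => through ((p.comp Y.mid).comp q)
  | _, _, _, through p, within _ => through p
  | _, _, _, within _, through q => through q
  | _, _, _, within h, within h' => within (h.trans h')

end PathLike

instance : Category (Obj P) where
  Hom := PathLike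
  id := PathLike.id
  comp := PathLike.comp
  id_comp := by
    intro X Y f
    cases f with
    | through p =>
      cases X with
      | vertex a =>
        change PathLike.through ((Quiver.Path.nil.comp Quiver.Path.nil).comp p) = _
        rw [Quiver.Path.nil_comp, Quiver.Path.nil_comp]
      | thread α x => rfl
    | within h => rfl
  comp_id := by
    intro X Y f
    cases f with
    | through p =>
      cases Y with
      | vertex a => rfl
      | thread α x => rfl
    | within h => rfl
  assoc := by
    intro W X Y Z f g h
    cases f <;> cases g <;> cases h <;> first
      | rfl
      | exact congrArg PathLike.through (by simp only [Quiver.Path.comp_assoc])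

/-- The `k`-linear path category `C` of the thread quiver `(Q, P)`: the hom space from `X` to `Y`
is the `k`-vector space with basis the path-like elements from `X` to `Y`, and composition is
extended bilinearly. -/
abbrev PathCat (k : Type κ) [Field k] (P : Quiver.Total Q → Type w) [∀ α, LinearOrder (P α)] :
    Type (max u v w) :=
  CategoryTheory.Free k (Obj P)

end PathCategory

section Quotients

/-- A (two-sided) ideal of a `k`-linear category: a family of subspaces of the hom spaces that is
closed under composition on both sides with arbitrary morphisms. -/
structure CatIdeal (k : Type κ) [Field k] (C : Type u) [Category.{v} C] [Preadditive C]
    [Linear k C] where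
  carrier (X Y : C) : Submodule k (X ⟶ Y)
  precomp_mem {X Y Z : C} (f : X ⟶ Y) {g : Y ⟶ Z} : g ∈ carrier Y Z → f ≫ g ∈ carrier X Z
  postcomp_mem {X Y Z : C} {f : X ⟶ Y} (g : Y ⟶ Z) : f ∈ carrier X Y → f ≫ g ∈ carrier X Z

variable {k : Type κ} [Field k] {C : Type u} [Category.{v} C] [Preadditive C] [Linear k C]

namespace CatIdeal

variable (I : CatIdeal k C)

/-- Two parallel morphisms are related if their difference lies in the ideal. -/
def rel : HomRel C := fun X Y f g => f - g ∈ I.carrier X Y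

instance : Congruence I.rel where
  equivalence :=
    { refl := fun f => by simp [rel]
      symm := fun {f g} h => by
        have := (I.carrier _ _).neg_mem h
        rwa [neg_sub] at this
      trans := fun {f g h} h₁ h₂ => by
        have := (I.carrier _ _).add_mem h₁ h₂
        rwa [sub_add_sub_cancel] at this }
  comp_left f g g' h := by
    have := I.precomp_mem f h
    rwa [Preadditive.comp_sub] at this
  comp_right g h := by
    have := I.postcomp_mem g h
    rwa [Preadditive.sub_comp] at this

/-- The quotient category `A = C / I`. -/
def Quot : Type u := CategoryTheory.Quotient I.rel

instance : Category I.Quot := inferInstanceAs (Category (CategoryTheory.Quotient I.rel))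

lemma rel_add ⦃X Y : C⦄ (f₁ f₂ g₁ g₂ : X ⟶ Y) (hf : I.rel f₁ f₂) (hg : I.rel g₁ g₂) :
    I.rel (f₁ + g₁) (f₂ + g₂) := by
  have := (I.carrier _ _).add_mem hf hg
  rwa [sub_add_sub_comm] at this

lemma rel_smul (a : k) ⦃X Y : C⦄ (f₁ f₂ : X ⟶ Y) (hf : I.rel f₁ f₂) :
    I.rel (a • f₁) (a • f₂) := by
  have := (I.carrier _ _).smul_mem a hf
  rwa [smul_sub] at this

instance : Preadditive I.Quot := CategoryTheory.Quotient.preadditive I.rel I.rel_add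

/-- The quotient functor `C ⥤ C / I`; it is the identity on objects. -/
def quotFunctor : C ⥤ I.Quot := CategoryTheory.Quotient.functor I.rel

instance : I.quotFunctor.Additive :=
  CategoryTheory.Quotient.functor_additive I.rel I.rel_add

instance : Linear k I.Quot :=
  letI : Preadditive (CategoryTheory.Quotient I.rel) :=
    CategoryTheory.Quotient.preadditive I.rel I.rel_add
  haveI : (CategoryTheory.Quotient.functor I.rel).Additive :=
    CategoryTheory.Quotient.functor_additive I.rel I.rel_add
  CategoryTheory.Quotient.linear k I.rel I.rel_smul

end CatIdeal

end Quotients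

section Representations

/-- A functor between `k`-linear categories is `k`-linear if it is additive and compatible with
the scalar multiplication on morphisms. -/
def linearFunctors (k : Type κ) [Field k] (A : Type u) [Category.{v} A] [Preadditive A]
    [Linear k A] : ObjectProperty (A ⥤ FGModuleCat.{m} k) :=
  fun M => M.Additive ∧ M.Linear k

/-- The category of pointwise finite-dimensional representations of a `k`-linear category `A`:
the full subcategory of `k`-linear functors in the category of covariant functors from `A` to
finite-dimensional `k`-vector spaces. -/
abbrev PwfRep (k : Type κ) [Field k] (A : Type u) [Category.{v} A] [Preadditive A]
    [Linear k A] :=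
  (linearFunctors.{u, v, κ, m} k A).FullSubcategory

variable {k : Type κ} [Field k] {A : Type u} [Category.{v} A] [Preadditive A] [Linear k A]

instance (J : Type) [SmallCategory J] [FinCategory J] :
    (linearFunctors.{u, v, κ, m} k A).IsClosedUnderLimitsOfShape J := by
  refine ⟨?_⟩
  rintro M ⟨pres⟩
  have hl : ∀ X : A, IsLimit (((evaluation A (FGModuleCat.{m} k)).obj X).mapCone _) :=
    fun X => isLimitOfPreserves _ pres.isLimit
  have hA : ∀ j, (pres.diag.obj j).Additive := fun j => (pres.prop_diag_obj j).1
  have hL : ∀ j, (pres.diag.obj j).Linear k := fun j => (pres.prop_diag_obj j).2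
  refine ⟨⟨?_⟩, ⟨?_⟩⟩
  · intro X Y f g
    refine (hl Y).hom_ext fun j => ?_
    change M.map (f + g) ≫ (pres.π.app j).app Y = (M.map f + M.map g) ≫ (pres.π.app j).app Y
    rw [Preadditive.add_comp]
    simp only [NatTrans.naturality]
    rw [← Preadditive.comp_add, (hA j).map_add]
  · intro X Y f r
    refine (hl Y).hom_ext fun j => ?_
    change M.map (r • f) ≫ (pres.π.app j).app Y = (r • M.map f) ≫ (pres.π.app j).app Y
    rw [Linear.smul_comp]
    simp only [NatTrans.naturality]
    rw [← Linear.comp_smul, (hL j).map_smul]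

instance : HasBinaryProducts (PwfRep.{u, v, κ, m} k A) :=
  inferInstanceAs (HasLimitsOfShape (Discrete WalkingPair) _)

instance : HasBinaryBiproducts (PwfRep.{u, v, κ, m} k A) :=
  HasBinaryBiproducts.of_hasBinaryProducts

/-- The family of morphisms `inc i : N i ⟶ M` exhibits the representation `M` as the direct sum
of the family `N`: for each object `x`, the induced map from `⨁ i, N i (x)` to `M (x)` is
bijective. -/
def IsDirectSum {ι : Type*} {M : PwfRep.{u, v, κ, m} k A} {N : ι → PwfRep.{u, v, κ, m} k A}
    (inc : ∀ i, N i ⟶ M) : Prop :=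
  letI := Classical.decEq ι
  ∀ x : A, Function.Bijective
    (DirectSum.toModule k ι (M.obj.obj x) fun i => ((inc i).hom.app x).hom.hom)

end Representations

section Noise

variable {k : Type κ} [Field k] {Q : Type u} [Quiver.{v} Q] {P : Quiver.Total Q → Type w}
  [∀ α, LinearOrder (P α)] {I : CatIdeal k (PathCat k P)}

/-- An object of the path category of `(Q, P)`, seen as an object of the quotient `A = C / I`. -/
noncomputable def toQuot (I : CatIdeal k (PathCat k P)) (X : Obj P) : I.Quot :=
  I.quotFunctor.obj (CategoryTheory.Free.of k X)

/-- A representation is noise if its support contains no vertex of `Q`. -/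
def IsNoise (M : PwfRep.{_, _, κ, m} k I.Quot) : Prop :=
  ∀ a : Q, Subsingleton (M.obj.obj (toQuot I (.vertex a)))

/-- A representation is noise free if it has no noise direct summand other than zero. -/
def IsNoiseFree (M : PwfRep.{_, _, κ, m} k I.Quot) : Prop :=
  ∀ N N' : PwfRep.{_, _, κ, m} k I.Quot, Nonempty (M ≅ N ⊞ N') → IsNoise N → IsZero N

/-- A representation is supported on the arrow `α` if its support is contained in `P α`. -/
def SupportedOn (α : Quiver.Total Q) (M : PwfRep.{_, _, κ, m} k I.Quot) : Prop :=
  ∀ X : Obj P, Nontrivial (M.obj.obj (toQuot I X)) → ∃ x : P α, X = .thread α x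

/-- A decomposition `M ≅ (⨁_λ Z_λ) ⊕ (⨁_α ⨁_η V_{α, η})` into indecomposable noise free
representations `Z_λ` and, for each arrow `α` of `Q`, indecomposable noise representations
`V_{α, η}` supported on `α`. -/
structure NoiseDecomposition (M : PwfRep.{_, _, κ, m} k I.Quot) where
  /-- the index set of the noise free summands -/
  Λ : Type ℓ
  /-- the index sets of the noise summands, one for each arrow -/
  H : Quiver.Total Q → Type ℓ
  Z : Λ → PwfRep.{_, _, κ, m} k I.Quot
  V : (α : Quiver.Total Q) → H α → PwfRep.{_, _, κ, m} k I.Quot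
  indecomposable_Z : ∀ l, Indecomposable (Z l)
  noiseFree_Z : ∀ l, IsNoiseFree (Z l)
  indecomposable_V : ∀ α η, Indecomposable (V α η)
  noise_V : ∀ α η, IsNoise (V α η)
  supportedOn_V : ∀ α η, SupportedOn α (V α η)
  /-- the inclusions of the noise free summands -/
  incZ : ∀ l, Z l ⟶ M
  /-- the inclusions of the noise summands -/
  incV : ∀ α η, V α η ⟶ M
  isDirectSum : IsDirectSum (ι := Λ ⊕ (Σ α, H α)) (M := M)
    (N := Sum.elim Z fun p => V p.1 p.2)
    (Sum.rec incZ fun p => incV p.1 p.2)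

end Noise

end ThreadQuiver

namespace ThreadQuiver

namespace PwfRep

variable {k : Type κ} [Field k] {A : Type u} [Category.{v} A] [Preadditive A] [Linear k A]

/-- The vector space `M (x)`. -/
abbrev space (M : PwfRep.{u, v, κ, m} k A) (x : A) : Type m := M.obj.obj x

/-- The linear map `M (f)`. -/
def act (M : PwfRep.{u, v, κ, m} k A) {x y : A} (f : x ⟶ y) : M.space x →ₗ[k] M.space y :=
  (M.obj.map f).hom.hom

/-- The component at `x` of a morphism of representations. -/
def app {M N : PwfRep.{u, v, κ, m} k A} (f : M ⟶ N) (x : A) : M.space x →ₗ[k] N.space x :=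
  (f.hom.app x).hom.hom

variable {M N L : PwfRep.{u, v, κ, m} k A}

lemma hom_ext {f g : M ⟶ N} (h : ∀ x v, app f x v = app g x v) : f = g := by
  apply ObjectProperty.hom_ext
  apply NatTrans.ext
  funext x
  apply FGModuleCat.hom_ext
  exact LinearMap.ext (h x)

@[simp] lemma app_id (x : A) (v : M.space x) : app (𝟙 M) x v = v := rfl

@[simp] lemma app_comp (f : M ⟶ N) (g : N ⟶ L) (x : A) (v : M.space x) :
    app (f ≫ g) x v = app g x (app f x v) := rfl

@[simp] lemma app_zero (x : A) (v : M.space x) : app (0 : M ⟶ N) x v = 0 := rfl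

@[simp] lemma app_add (f g : M ⟶ N) (x : A) (v : M.space x) :
    app (f + g) x v = app f x v + app g x v := rfl

@[simp] lemma app_mul (f g : End M) (x : A) : app (f * g : End M) x = app f x * app g x := rfl

@[simp] lemma app_pow (f : End M) (x : A) (n : ℕ) : app (f ^ n : End M) x = app f x ^ n := by
  induction n with
  | zero => rfl
  | succ n ih => rw [pow_succ, pow_succ, app_mul, ih]

lemma app_act (f : M ⟶ N) {x y : A} (a : x ⟶ y) (v : M.space x) :
    app f y (M.act a v) = N.act a (app f x v) :=
  congrArg (fun φ => φ.hom.hom v) (f.hom.naturality a)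

/-- A natural family of linear maps is a morphism of representations. -/
def homMk (φ : ∀ x, M.space x →ₗ[k] N.space x)
    (h : ∀ {x y : A} (a : x ⟶ y) (v : M.space x), φ y (M.act a v) = N.act a (φ x v)) : M ⟶ N :=
  ObjectProperty.homMk
    { app := fun x => ObjectProperty.homMk (ModuleCat.ofHom (φ x))
      naturality := fun _ _ a => FGModuleCat.hom_ext (LinearMap.ext (h a)) }

/-- A pointwise bijective morphism of representations is an isomorphism. -/
noncomputable def isoOfBijective (f : M ⟶ N) (h : ∀ x, Function.Bijective (app f x)) : M ≅ N where
  hom := f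
  inv := homMk (fun x => (LinearEquiv.ofBijective (app f x) (h x)).symm.toLinearMap) (by
    intro x y a v
    apply (h y).1
    rw [app_act]
    exact ((LinearEquiv.ofBijective (app f y) (h y)).apply_symm_apply _).trans
      (congrArg _ ((LinearEquiv.ofBijective (app f x) (h x)).apply_symm_apply v).symm))
  hom_inv_id := hom_ext fun x v => (LinearEquiv.ofBijective (app f x) (h x)).symm_apply_apply v
  inv_hom_id := hom_ext fun x v => (LinearEquiv.ofBijective (app f x) (h x)).apply_symm_apply v

lemma isUnit_of_bijective (f : End M) (h : ∀ x, Function.Bijective (app f x)) : IsUnit f :=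
  ⟨⟨f, (isoOfBijective f h).inv, (isoOfBijective f h).inv_hom_id,
    (isoOfBijective f h).hom_inv_id⟩, rfl⟩

/-- The linear equivalences that are the components of an isomorphism. -/
def spaceEquiv (e : M ≅ N) (x : A) : M.space x ≃ₗ[k] N.space x :=
  LinearEquiv.ofLinearMap (app e.hom x) (app e.inv x)
    (LinearMap.ext fun v => by
      change app (e.inv ≫ e.hom) x v = v
      rw [e.inv_hom_id]; rfl)
    (LinearMap.ext fun v => by
      change app (e.hom ≫ e.inv) x v = v
      rw [e.hom_inv_id]; rfl)

lemma isZero_iff : IsZero M ↔ ∀ x, Subsingleton (M.space x) := by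
  constructor
  · intro h x
    have h0 : 𝟙 M = 0 := h.eq_of_src _ _
    refine ⟨fun v v' => ?_⟩
    have (v : M.space x) : v = 0 := by
      rw [← app_id x v, h0]; rfl
    rw [this v, this v']
  · intro h
    rw [IsZero.iff_id_eq_zero]
    exact hom_ext fun x v => Subsingleton.elim _ _

lemma exists_nontrivial (h : ¬ IsZero M) : ∃ x, Nontrivial (M.space x) := by
  simpa only [isZero_iff, not_forall, not_subsingleton_iff_nontrivial] using h

section SubRep

/-- A subrepresentation: a family of subspaces preserved by all the maps `M (f)`. -/
structure SubRep (M : PwfRep.{u, v, κ, m} k A) where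
  carrier (x : A) : Submodule k (M.space x)
  act_mem {x y : A} (a : x ⟶ y) {v : M.space x} : v ∈ carrier x → M.act a v ∈ carrier y

namespace SubRep

/-- A subrepresentation as a representation. -/
def toRep (S : SubRep M) : PwfRep.{u, v, κ, m} k A where
  obj :=
    { obj := fun x => FGModuleCat.of k (S.carrier x)
      map := fun a => ObjectProperty.homMk (ModuleCat.ofHom
        ((M.act a).restrict fun _ hv => S.act_mem a hv))
      map_id := fun x => FGModuleCat.hom_ext (LinearMap.ext fun v => Subtype.ext
        (congrArg (fun φ => φ.hom.hom v.1) (M.obj.map_id x)))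
      map_comp := fun a b => FGModuleCat.hom_ext (LinearMap.ext fun v => Subtype.ext
        (congrArg (fun φ => φ.hom.hom v.1) (M.obj.map_comp a b))) }
  property := by
    have := M.property.1
    have := M.property.2
    refine ⟨⟨?_⟩, ⟨?_⟩⟩
    · intro x y a b
      exact FGModuleCat.hom_ext (LinearMap.ext fun v => Subtype.ext
        (congrArg (fun φ => φ.hom.hom v.1) (M.obj.map_add (f := a) (g := b))))
    · intro x y a r
      exact FGModuleCat.hom_ext (LinearMap.ext fun v => Subtype.ext
        (congrArg (fun φ => φ.hom.hom v.1) (M.obj.map_smul r a)))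

/-- The inclusion of a subrepresentation. -/
def incl (S : SubRep M) : S.toRep ⟶ M :=
  homMk (fun x => (S.carrier x).subtype) fun _ _ => rfl

lemma isZero_toRep_iff (S : SubRep M) : IsZero S.toRep ↔ ∀ x, S.carrier x = ⊥ := by
  rw [isZero_iff]
  exact forall_congr' fun x => Submodule.subsingleton_iff_eq_bot

/-- A representation is the direct sum of two complementary subrepresentations. -/
lemma nonempty_iso_biprod (S T : SubRep M) (h : ∀ x, IsCompl (S.carrier x) (T.carrier x)) :
    Nonempty (M ≅ S.toRep ⊞ T.toRep) := by
  refine ⟨(isoOfBijective (biprod.desc S.incl T.incl) fun x => ?_).symm⟩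
  have key (z : (S.toRep ⊞ T.toRep).space x) :
      z = app biprod.inl x (app biprod.fst x z) + app biprod.inr x (app biprod.snd x z) := by
    rw [← app_comp, ← app_comp, ← app_add, biprod.total, app_id]
  have inl (s) : app (biprod.desc S.incl T.incl) x (app biprod.inl x s) = (s : S.carrier x).1 := by
    rw [← app_comp, biprod.inl_desc]; rfl
  have inr (t) : app (biprod.desc S.incl T.incl) x (app biprod.inr x t) = (t : T.carrier x).1 := by
    rw [← app_comp, biprod.inr_desc]; rfl
  constructor
  · rw [injective_iff_map_eq_zero]
    intro z hz
    rw [key z, map_add, inl, inr] at hz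
    have h1 : (app biprod.fst x z : S.carrier x) = 0 := by
      apply Subtype.ext
      refine Submodule.disjoint_def.1 (h x).disjoint _ (Subtype.prop _) ?_
      rw [eq_neg_of_add_eq_zero_left hz]
      exact Submodule.neg_mem _ (Subtype.prop _)
    have h2 : (app biprod.snd x z : T.carrier x) = 0 := by
      rw [h1] at hz
      exact Subtype.ext ((zero_add _).symm.trans hz)
    rw [key z, h1, h2]
    simp
  · intro v
    obtain ⟨s, hs, t, ht, rfl⟩ := Submodule.mem_sup.1
      ((h x).sup_eq_top.symm ▸ Submodule.mem_top : v ∈ S.carrier x ⊔ T.carrier x)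
    exact ⟨app biprod.inl x (⟨s, hs⟩ : S.carrier x) + app biprod.inr x (⟨t, ht⟩ : T.carrier x),
      (map_add _ _ _).trans (congrArg₂ (· + ·) (inl _) (inr _))⟩

lemma eq_bot_or_eq_bot (hM : Indecomposable M) (S T : SubRep M)
    (h : ∀ x, IsCompl (S.carrier x) (T.carrier x)) :
    (∀ x, S.carrier x = ⊥) ∨ (∀ x, T.carrier x = ⊥) := by
  obtain ⟨e⟩ := nonempty_iso_biprod S T h
  simpa only [isZero_toRep_iff] using hM.2 _ _ e

end SubRep

end SubRep

/-- The endomorphism ring of an indecomposable pointwise finite-dimensional representation is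
local, by Fitting's lemma. -/
theorem isLocalRing_end (hM : Indecomposable M) : IsLocalRing (End M) := by
  have : Nontrivial (End M) := by
    refine ⟨⟨1, 0, fun h => hM.1 ?_⟩⟩
    rw [IsZero.iff_id_eq_zero]
    exact h
  refine IsLocalRing.of_isUnit_or_isUnit_one_sub_self fun θ => ?_
  let S : SubRep M :=
    { carrier := fun x => ⨆ n, LinearMap.ker (app θ x ^ n)
      act_mem := by
        intro x y a v hv
        have mono (x : A) : Monotone fun n => LinearMap.ker (app θ x ^ n) := fun i j hij v hv => by
          rw [LinearMap.mem_ker] at hv ⊢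
          rw [← Nat.sub_add_cancel hij, pow_add, Module.End.mul_apply, hv, map_zero]
        rw [Submodule.mem_iSup_of_directed _ (mono _).directed_le] at hv ⊢
        obtain ⟨n, hn⟩ := hv
        refine ⟨n, ?_⟩
        rw [LinearMap.mem_ker, ← app_pow] at hn ⊢
        rw [app_act, hn, map_zero] }
  let T : SubRep M :=
    { carrier := fun x => ⨅ n, LinearMap.range (app θ x ^ n)
      act_mem := by
        intro x y a v hv
        rw [Submodule.mem_iInf] at hv ⊢
        intro n
        obtain ⟨v', rfl⟩ := hv n
        exact ⟨M.act a v', by rw [← app_pow, app_act, app_pow]⟩ }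
  have hST (x : A) : IsCompl (S.carrier x) (T.carrier x) :=
    (app θ x).isCompl_iSup_ker_pow_iInf_range_pow
  rcases SubRep.eq_bot_or_eq_bot hM S T hST with h | h
  · left
    refine isUnit_of_bijective θ fun x => ?_
    have hinj : Function.Injective (app θ x) := by
      rw [← LinearMap.ker_eq_bot, eq_bot_iff, ← h x]
      exact (congrArg LinearMap.ker (pow_one (app θ x))).ge.trans
        (le_iSup (fun n => LinearMap.ker (app θ x ^ n)) 1)
    exact ⟨hinj, LinearMap.injective_iff_surjective.1 hinj⟩
  · right
    refine isUnit_of_bijective _ fun x => ?_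
    have hinj : Function.Injective (app (1 - θ) x) := by
      rw [injective_iff_map_eq_zero]
      intro v hv
      have hv' : app θ x v = v := by
        have : v - app θ x v = 0 := hv
        exact (sub_eq_zero.1 this).symm
      have hmem : v ∈ T.carrier x := by
        refine Submodule.mem_iInf _ |>.2 fun n => ⟨v, ?_⟩
        induction n with
        | zero => rfl
        | succ n ih => rw [pow_succ, Module.End.mul_apply, hv', ih]
      rwa [h x, Submodule.mem_bot] at hmem
    exact ⟨hinj, LinearMap.injective_iff_surjective.1 hinj⟩

end PwfRep

end ThreadQuiver
namespace ThreadQuiver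

namespace IsDirectSum

open PwfRep

variable {k : Type κ} [Field k] {A : Type u} [Category.{v} A] [Preadditive A] [Linear k A]
  {ι : Type ℓ} {M : PwfRep.{u, v, κ, m} k A} {N : ι → PwfRep.{u, v, κ, m} k A}
  {inc : ∀ i, N i ⟶ M}

lemma of_iSupIndep (hinj : ∀ i x, Function.Injective (app (inc i) x))
    (hind : ∀ x, iSupIndep fun i => LinearMap.range (app (inc i) x))
    (htop : ∀ x, ⨆ i, LinearMap.range (app (inc i) x) = ⊤) : IsDirectSum inc := by
  classical
  intro x
  have hint : DirectSum.IsInternal fun i => LinearMap.range (app (inc i) x) :=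
    (DirectSum.isInternal_submodule_iff_iSupIndep_and_iSup_eq_top _).2 ⟨hind x, htop x⟩
  have hcomp : DirectSum.toModule k ι (M.space x) (fun i => app (inc i) x) =
      (DirectSum.coeLinearMap fun i => LinearMap.range (app (inc i) x)) ∘ₗ
        (DFinsupp.mapRange.linearEquiv fun i =>
          LinearEquiv.ofInjective (app (inc i) x) (hinj i x)).toLinearMap := by
    refine DirectSum.linearMap_ext k fun i => LinearMap.ext fun n => ?_
    refine (DirectSum.toModule_lof (φ := fun i => app (inc i) x) k i n).trans ?_
    have hmap : (DFinsupp.mapRange.linearEquiv fun i =>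
        LinearEquiv.ofInjective (app (inc i) x) (hinj i x))
          (DirectSum.lof k ι (fun i => (N i).space x) i n) =
        DirectSum.lof k ι (fun i => LinearMap.range (app (inc i) x)) i
          (LinearEquiv.ofInjective (app (inc i) x) (hinj i x) n) :=
      DFinsupp.mapRange_single (hf := fun i => map_zero _)
    exact ((congrArg (DirectSum.coeLinearMap _) hmap).trans
      (DirectSum.coeLinearMap_lof _ _ _)).symm
  have : Function.Bijective (DirectSum.toModule k ι (M.space x) fun i => app (inc i) x) := by
    rw [hcomp]
    exact hint.comp (LinearEquiv.bijective _)
  convert this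
  rfl

variable (h : IsDirectSum inc)

include h in
lemma bijective [DecidableEq ι] (x : A) :
    Function.Bijective (DirectSum.toModule k ι (M.space x) fun i => app (inc i) x) := by
  convert h x
  rfl

open Classical in
/-- The pointwise isomorphism between a direct sum and the direct sum of the spaces. -/
noncomputable def equiv (x : A) : (⨁ i, (N i).space x) ≃ₗ[k] M.space x :=
  LinearEquiv.ofBijective (DirectSum.toModule k ι (M.space x) fun i => app (inc i) x)
    (h.bijective x)

open Classical in
lemma equiv_lof (x : A) (i : ι) (n : (N i).space x) :
    h.equiv x (DirectSum.lof k ι (fun i => (N i).space x) i n) = app (inc i) x n :=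
  DirectSum.toModule_lof (φ := fun i => app (inc i) x) k i n

open Classical in
lemma equiv_symm_inc (x : A) (i : ι) (n : (N i).space x) :
    (h.equiv x).symm (app (inc i) x n) = DirectSum.lof k ι (fun i => (N i).space x) i n := by
  rw [← h.equiv_lof, LinearEquiv.symm_apply_apply]

include h in
lemma space_induction {x : A} {p : M.space x → Prop} (zero : p 0)
    (inc : ∀ i n, p (app (inc i) x n)) (add : ∀ v w, p v → p w → p (v + w)) (v : M.space x) :
    p v := by
  classical
  obtain ⟨z, rfl⟩ := (h.equiv x).surjective v
  induction z using DirectSum.induction_on with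
  | zero => rw [map_zero]; exact zero
  | of i n => exact (h.equiv_lof x i n).symm ▸ inc i n
  | add y z hy hz => rw [map_add]; exact add _ _ hy hz

include h in
lemma hom_ext {L : PwfRep.{u, v, κ, m} k A} {f g : M ⟶ L} (hfg : ∀ i, inc i ≫ f = inc i ≫ g) :
    f = g := by
  refine PwfRep.hom_ext fun x v => ?_
  induction v using h.space_induction with
  | zero => rw [map_zero, map_zero]
  | inc i n => rw [← app_comp, hfg, app_comp]
  | add v w hv hw => rw [map_add, map_add, hv, hw]

/-- The projections of a direct sum to its summands. -/
noncomputable def proj (i : ι) : M ⟶ N i :=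
  homMk (fun x => DirectSum.component k ι (fun i => (N i).space x) i ∘ₗ (h.equiv x).symm) (by
    classical
    intro x y a v
    induction v using h.space_induction with
    | zero => simp only [map_zero]
    | inc j n =>
      simp only [LinearMap.comp_apply, LinearEquiv.coe_coe]
      rw [← app_act, equiv_symm_inc, equiv_symm_inc]
      by_cases hij : i = j
      · subst hij
        rw [DirectSum.component.lof_self, DirectSum.component.lof_self]
      · rw [DirectSum.component.of, DirectSum.component.of, dif_neg (Ne.symm hij),
          dif_neg (Ne.symm hij), map_zero]
    | add v w hv hw => simp only [map_add, hv, hw])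

lemma app_proj (i : ι) (x : A) (v : M.space x) : app (h.proj i) x v = (h.equiv x).symm v i := rfl

@[simp] lemma inc_proj (i : ι) : inc i ≫ h.proj i = 𝟙 (N i) := by
  classical
  refine PwfRep.hom_ext fun x n => ?_
  rw [app_comp, app_proj, equiv_symm_inc]
  exact DirectSum.component.lof_self (M := fun i => (N i).space x) k i n

lemma inc_proj_of_ne {i j : ι} (hij : i ≠ j) : inc i ≫ h.proj j = 0 := by
  classical
  refine PwfRep.hom_ext fun x n => ?_
  rw [app_comp, app_proj, equiv_symm_inc]
  exact (DirectSum.component.of (M := fun i => (N i).space x) k j i n).trans (dif_neg hij)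

include h in
lemma exists_eq_sum {x : A} (v : M.space x) :
    ∃ s : Finset ι, v = ∑ i ∈ s, app (inc i) x (app (h.proj i) x v) := by
  classical
  obtain ⟨z, rfl⟩ := (h.equiv x).surjective v
  refine ⟨DFinsupp.support z, ?_⟩
  simp only [app_proj, LinearEquiv.symm_apply_apply, ← h.equiv_lof]
  rw [← map_sum]
  exact congrArg _ (DirectSum.sum_support_of z).symm

include h in
lemma injective (i : ι) (x : A) : Function.Injective (app (inc i) x) := by
  refine Function.LeftInverse.injective (g := app (h.proj i) x) fun n => ?_
  rw [← app_comp, inc_proj, app_id]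

include h in
lemma iSupIndep_range (x : A) : iSupIndep fun i => LinearMap.range (app (inc i) x) := by
  intro i
  rw [Submodule.disjoint_def]
  rintro _ ⟨n, rfl⟩ hn
  have hle : ⨆ j, ⨆ (_ : j ≠ i), LinearMap.range (app (inc j) x) ≤
      LinearMap.ker (app (h.proj i) x) := by
    refine iSup₂_le fun j hj => ?_
    rintro _ ⟨n', rfl⟩
    rw [LinearMap.mem_ker, ← app_comp, h.inc_proj_of_ne hj, app_zero]
  have := hle hn
  rw [LinearMap.mem_ker, ← app_comp, inc_proj, app_id] at this
  rw [this, map_zero]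

include h in
lemma finite_nontrivial (x : A) : {i | Nontrivial ((N i).space x)}.Finite := by
  refine (WellFoundedGT.finite_ne_bot_of_iSupIndep (h.iSupIndep_range x)).subset fun i hi => ?_
  have : Nontrivial ((N i).space x) := hi
  obtain ⟨n, hn⟩ := exists_ne (0 : (N i).space x)
  intro hbot
  refine hn (h.injective i x ?_)
  rw [map_zero, ← Submodule.mem_bot k, ← hbot]
  exact ⟨n, rfl⟩

include h in
lemma iSup_range (x : A) : ⨆ i, LinearMap.range (app (inc i) x) = ⊤ := by
  refine Submodule.eq_top_iff'.2 fun v => ?_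
  induction v using h.space_induction with
  | zero => exact Submodule.zero_mem _
  | inc i n => exact Submodule.mem_iSup_of_mem i ⟨n, rfl⟩
  | add v w hv hw => exact Submodule.add_mem _ hv hw

include h in
lemma congr {ι' : Type ℓ'} {N' : ι' → PwfRep.{u, v, κ, m} k A} {inc' : ∀ i, N' i ⟶ M}
    (e : ι' ≃ ι) (φ : ∀ i, N' i ≅ N (e i)) (hφ : ∀ i, inc' i = (φ i).hom ≫ inc (e i)) :
    IsDirectSum inc' := by
  have hrange (i : ι') (x : A) : LinearMap.range (app (inc' i) x) =
      LinearMap.range (app (inc (e i)) x) := by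
    rw [hφ]
    exact LinearMap.range_comp_of_range_eq_top _ (spaceEquiv (φ i) x).range
  refine of_iSupIndep (fun i x => ?_) (fun x => ?_) fun x => ?_
  · rw [hφ]
    exact (h.injective (e i) x).comp (spaceEquiv (φ i) x).injective
  · simp only [hrange]
    exact (h.iSupIndep_range x).comp e.injective
  · simp only [hrange]
    rw [e.iSup_comp (g := fun i => LinearMap.range (app (inc i) x)), h.iSup_range]

end IsDirectSum

end ThreadQuiver
namespace ThreadQuiver

namespace PwfRep

variable {k : Type κ} [Field k] {A : Type u} [Category.{v} A] [Preadditive A] [Linear k A]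

lemma indecomposable_of_iso {X Y : PwfRep.{u, v, κ, m} k A} (e : X ≅ Y) (h : Indecomposable X) :
    Indecomposable Y :=
  ⟨fun hY => h.1 (hY.of_iso e), fun _ _ i => h.2 _ _ (e ≪≫ i)⟩

lemma bijective_of_isUnit {X : PwfRep.{u, v, κ, m} k A} {φ : End X} (h : IsUnit φ) (x : A) :
    Function.Bijective (app φ x) := by
  obtain ⟨⟨φ, ψ, h₁, h₂⟩, rfl⟩ := h
  refine Function.bijective_iff_has_inverse.2 ⟨app ψ x, fun s => ?_, fun s => ?_⟩
  · exact congrArg (fun f : End X => app f x s) h₂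
  · exact congrArg (fun f : End X => app f x s) h₁

lemma nonempty_iso_of_isUnit_comp {X Y : PwfRep.{u, v, κ, m} k A} (hX : ¬ IsZero X)
    (hY : IsLocalRing (End Y)) (f : X ⟶ Y) (g : Y ⟶ X) (h : IsUnit (M := End X) (f ≫ g)) :
    Nonempty (Y ≅ X) := by
  have hf (x : A) : Function.Injective (app f x) :=
    Function.Injective.of_comp (f := app g x) (bijective_of_isUnit h x).1
  obtain ⟨w, hw⟩ : ∃ w : X ⟶ X, f ≫ g ≫ w = 𝟙 X := by
    obtain ⟨u, hu⟩ := h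
    refine ⟨(↑u⁻¹ : End X), ?_⟩
    rw [← Category.assoc, ← hu]
    exact u.inv_mul
  rcases IsLocalRing.isUnit_or_isUnit_of_add_one
    (a := show End Y from (g ≫ w) ≫ f) (b := show End Y from 𝟙 Y - (g ≫ w) ≫ f)
    (add_sub_cancel (G := End Y) _ _) with he | he
  · refine ⟨isoOfBijective (g ≫ w) fun x => ⟨?_, fun s => ⟨app f x s, ?_⟩⟩⟩
    · exact Function.Injective.of_comp (f := app f x) (bijective_of_isUnit he x).1
    · rw [← app_comp, hw, app_id]
  · refine (hX ?_).elim
    rw [IsZero.iff_id_eq_zero]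
    refine hom_ext fun x s => hf x ((bijective_of_isUnit he x).1 ?_)
    rw [app_id, app_zero, map_zero, map_zero, ← app_comp, Preadditive.comp_sub, Category.comp_id,
      ← Category.assoc, hw, Category.id_comp, sub_self, app_zero]

lemma exists_submodule_le_ker_of_not_isUnit {X : PwfRep.{u, v, κ, m} k A}
    (hX : IsLocalRing (End X)) {x : A} (hx : Nontrivial (X.space x)) :
    ∃ S : Submodule k (X.space x), S ≠ ⊥ ∧ (∀ φ : End X, ∀ s ∈ S, app φ x s ∈ S) ∧
      ∀ φ : End X, ¬ IsUnit φ → ∀ s ∈ S, app φ x s = 0 := by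
  obtain ⟨S, ⟨hS, hstab⟩, hmin⟩ := WellFounded.has_min
    (wellFounded_lt (α := Submodule k (X.space x)))
    {S | S ≠ ⊥ ∧ ∀ φ : End X, ∀ s ∈ S, app φ x s ∈ S}
    ⟨⊤, top_ne_bot, fun _ _ _ => Submodule.mem_top⟩
  refine ⟨S, hS, hstab, fun φ hφ s hs => by_contra fun hne => ?_⟩
  let T : Submodule k (X.space x) :=
    { carrier := {t | ∃ ψ : End X, app ψ x (app φ x s) = t}
      zero_mem' := ⟨0, rfl⟩
      add_mem' := by
        rintro _ _ ⟨ψ, rfl⟩ ⟨ψ', rfl⟩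
        exact ⟨ψ + ψ', rfl⟩
      smul_mem' := by
        rintro r _ ⟨ψ, rfl⟩
        refine ⟨homMk (fun y => r • app ψ y) fun a v => ?_, rfl⟩
        rw [LinearMap.smul_apply, LinearMap.smul_apply, app_act, map_smul] }
  have hTS : T ≤ S := by
    rintro _ ⟨ψ, rfl⟩
    exact hstab _ _ (hstab _ _ hs)
  have hT : T ≠ ⊥ := by
    intro h
    refine hne ?_
    rw [← Submodule.mem_bot k, ← h]
    exact ⟨1, rfl⟩
  have hTstab : ∀ θ : End X, ∀ t ∈ T, app θ x t ∈ T := by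
    rintro θ _ ⟨ψ, rfl⟩
    exact ⟨θ * ψ, rfl⟩
  have hsT : s ∈ T := by
    have : T = S := by
      by_contra h
      exact hmin T ⟨hT, hTstab⟩ (lt_of_le_of_ne hTS h)
    rwa [this]
  obtain ⟨ψ, hψ⟩ := hsT
  rcases IsLocalRing.isUnit_or_isUnit_of_add_one (a := ψ * φ) (b := 1 - ψ * φ)
    (add_sub_cancel _ _) with h | h
  · refine hφ (isUnit_of_bijective φ fun y => ?_)
    have hinj : Function.Injective (app φ y) :=
      Function.Injective.of_comp (f := app ψ y) (bijective_of_isUnit h y).1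
    exact ⟨hinj, LinearMap.injective_iff_surjective.1 hinj⟩
  · refine hne ?_
    have hs0 : s = 0 := (bijective_of_isUnit h x).1 <| by
      rw [map_zero]
      exact sub_eq_zero.2 hψ.symm
    rw [hs0, map_zero]

end PwfRep

namespace IsDirectSum

open PwfRep

variable {k : Type κ} [Field k] {A : Type u} [Category.{v} A] [Preadditive A] [Linear k A]
  {ι : Type ℓ} {M : PwfRep.{u, v, κ, m} k A} {N : ι → PwfRep.{u, v, κ, m} k A}
  {inc : ∀ i, N i ⟶ M}
  {ι' : Type ℓ'} {N' : ι' → PwfRep.{u, v, κ, m} k A} {inc' : ∀ i, N' i ⟶ M}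

lemma finite_iso (h : IsDirectSum inc) {X : PwfRep.{u, v, κ, m} k A} (hX : ¬ IsZero X) :
    Finite {i // Nonempty (N i ≅ X)} := by
  obtain ⟨x, hx⟩ := exists_nontrivial hX
  refine ((h.finite_nontrivial x).subset ?_).to_subtype
  rintro i ⟨e⟩
  exact (spaceEquiv e x).toEquiv.nontrivial

lemma card_iso_le (h : IsDirectSum inc) (h' : IsDirectSum inc')
    (hN' : ∀ j, IsLocalRing (End (N' j))) {X : PwfRep.{u, v, κ, m} k A} (hX : ¬ IsZero X)
    (hlocal : IsLocalRing (End X)) :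
    Nat.card {i // Nonempty (N i ≅ X)} ≤ Nat.card {j // Nonempty (N' j ≅ X)} := by
  classical
  have := h.finite_iso hX
  have := h'.finite_iso hX
  have := Fintype.ofFinite {i // Nonempty (N i ≅ X)}
  have := Fintype.ofFinite {j // Nonempty (N' j ≅ X)}
  obtain ⟨x, hx⟩ := exists_nontrivial hX
  obtain ⟨S, hS, hstab, hker⟩ := exists_submodule_le_ker_of_not_isUnit hlocal hx
  choose φ hφ using fun i : {i // Nonempty (N i ≅ X)} => exists_true_iff_nonempty.2 i.2
  choose ψ hψ using fun j : {j // Nonempty (N' j ≅ X)} => exists_true_iff_nonempty.2 j.2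
  let f (i : {i // Nonempty (N i ≅ X)}) : X ⟶ M := (φ i).inv ≫ inc i.1
  let g (i : {i // Nonempty (N i ≅ X)}) : M ⟶ X := h.proj i.1 ≫ (φ i).hom
  have hfg (i j) (s : X.space x) : app (g j) x (app (f i) x s) = if i = j then s else 0 := by
    rw [← app_comp]
    have : f i ≫ g j = (φ i).inv ≫ (inc i.1 ≫ h.proj j.1) ≫ (φ j).hom := by
      simp only [f, g, Category.assoc]
    rw [this]
    split_ifs with hij
    · subst hij
      rw [inc_proj, Category.id_comp, Iso.inv_hom_id, app_id]
    · rw [h.inc_proj_of_ne (fun he => hij (Subtype.ext he)), zero_comp, comp_zero, app_zero]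
  let B (j : {j // Nonempty (N' j ≅ X)}) (i : {i // Nonempty (N i ≅ X)}) : End X :=
    f i ≫ h'.proj j.1 ≫ (ψ j).hom
  let Φ : ({i // Nonempty (N i ≅ X)} → S) →ₗ[k] ({j // Nonempty (N' j ≅ X)} → S) :=
    LinearMap.pi fun j => ∑ i, (app (B j i) x).restrict (hstab (B j i)) ∘ₗ LinearMap.proj i
  have hΦ : Function.Injective Φ := by
    rw [injective_iff_map_eq_zero]
    intro s hs
    let z : M.space x := ∑ i, app (f i) x (s i).1
    have hz (j : ι') (hj : Nonempty (N' j ≅ X)) : app (h'.proj j) x z = 0 := by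
      apply (spaceEquiv (ψ ⟨j, hj⟩) x).injective
      have h0 : ((Φ s ⟨j, hj⟩ : S) : X.space x) = 0 := by rw [hs]; rfl
      rw [map_zero, ← h0]
      simp only [Φ, z, map_sum, LinearMap.pi_apply, LinearMap.sum_apply, Submodule.coe_sum]
      rfl
    have hgz (a) : app (g a) x z = 0 := by
      obtain ⟨t, ht⟩ := h'.exists_eq_sum z
      rw [ht, map_sum]
      refine Finset.sum_eq_zero fun j _ => ?_
      by_cases hj : Nonempty (N' j ≅ X)
      · rw [hz j hj, map_zero, map_zero]
      · simp only [z, map_sum]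
        refine Finset.sum_eq_zero fun b _ => ?_
        refine hker ((f b ≫ h'.proj j) ≫ inc' j ≫ g a) (fun hu => hj ?_) _ (s b).2
        exact nonempty_iso_of_isUnit_comp hX (hN' j) _ _ hu
    funext a
    refine Subtype.ext ?_
    have := hgz a
    simp only [z, map_sum, hfg, Finset.sum_ite_eq', Finset.mem_univ, if_true] at this
    exact this
  have hle := LinearMap.finrank_le_finrank_of_injective hΦ
  rw [Module.finrank_pi_fintype, Module.finrank_pi_fintype, Finset.sum_const, Finset.sum_const,
    smul_eq_mul, smul_eq_mul, Finset.card_univ, Finset.card_univ] at hle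
  have : Nontrivial S := Submodule.nontrivial_iff_ne_bot.2 hS
  rw [Nat.card_eq_fintype_card, Nat.card_eq_fintype_card]
  exact Nat.le_of_mul_le_mul_right hle Module.finrank_pos

/-- **Krull–Remak–Schmidt–Azumaya theorem** for pointwise finite-dimensional representations. -/
theorem exists_equiv (h : IsDirectSum inc) (h' : IsDirectSum inc')
    (hN : ∀ i, Indecomposable (N i)) (hN' : ∀ j, Indecomposable (N' j)) :
    ∃ e : ι ≃ ι', ∀ i, Nonempty (N i ≅ N' (e i)) := by
  have hfib (X : PwfRep.{u, v, κ, m} k A) :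
      Nonempty ({i // Nonempty (N i ≅ X)} ≃ {j // Nonempty (N' j ≅ X)}) := by
    by_cases hX : Indecomposable X
    · have := h.finite_iso hX.1
      have := h'.finite_iso hX.1
      exact Finite.card_eq.1 (le_antisymm
        (h.card_iso_le h' (fun j => isLocalRing_end (hN' j)) hX.1 (isLocalRing_end hX))
        (h'.card_iso_le h (fun i => isLocalRing_end (hN i)) hX.1 (isLocalRing_end hX)))
    · have : IsEmpty {i // Nonempty (N i ≅ X)} :=
        ⟨fun i => i.2.elim fun e => hX (indecomposable_of_iso e (hN _))⟩
      have : IsEmpty {j // Nonempty (N' j ≅ X)} :=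
        ⟨fun j => j.2.elim fun e => hX (indecomposable_of_iso e (hN' _))⟩
      exact ⟨Equiv.equivOfIsEmpty _ _⟩
  let c (X : PwfRep.{u, v, κ, m} k A) : Quotient (isIsomorphicSetoid (PwfRep.{u, v, κ, m} k A)) :=
    Quotient.mk _ X
  have hc (X Y : PwfRep.{u, v, κ, m} k A) : c X = c Y ↔ Nonempty (X ≅ Y) := Quotient.eq
  have hfib' (q) : Nonempty ({i // c (N i) = q} ≃ {j // c (N' j) = q}) := by
    induction q using Quotient.inductionOn with
    | h X =>
      obtain ⟨e⟩ := hfib X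
      exact ⟨((Equiv.subtypeEquivRight fun i => hc (N i) X).trans e).trans
        (Equiv.subtypeEquivRight fun j => hc (N' j) X).symm⟩
  choose e he using fun q => exists_true_iff_nonempty.2 (hfib' q)
  refine ⟨Equiv.ofFiberEquiv e, fun i => ?_⟩
  rw [← hc]
  exact (Equiv.ofFiberEquiv_map e i).symm

end IsDirectSum

end ThreadQuiver
namespace ThreadQuiver

section Idempotents

variable {k : Type κ} [Field k] {V : Type*} [AddCommGroup V] [Module k V]

lemma apply_eq_smul_of_mem_maxGenEigenspace {f : Module.End k V} (hf : IsIdempotentElem f) {μ : k}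
    {v : V} (hv : v ∈ f.maxGenEigenspace μ) : f v = μ • v := by
  rw [Module.End.mem_maxGenEigenspace] at hv
  obtain ⟨n, hn⟩ := hv
  have hff (w : V) : f (f w) = f w := LinearMap.congr_fun hf w
  have h₁ (n : ℕ) : f (((f - μ • (1 : Module.End k V)) ^ n) v) = (1 - μ) ^ n • f v := by
    induction n with
    | zero => simp
    | succ n ih =>
      rw [pow_succ', Module.End.mul_apply, LinearMap.sub_apply, map_sub, LinearMap.smul_apply,
        Module.End.one_apply, map_smul, hff, ih, pow_succ', mul_smul, sub_smul, one_smul]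
  have h₂ (n : ℕ) : ((f - μ • (1 : Module.End k V)) ^ n) v -
      f (((f - μ • (1 : Module.End k V)) ^ n) v) = (-μ) ^ n • (v - f v) := by
    induction n with
    | zero => simp
    | succ n ih =>
      rw [pow_succ' (-μ), mul_smul, ← ih, pow_succ', Module.End.mul_apply]
      simp only [LinearMap.sub_apply, map_sub, LinearMap.smul_apply, Module.End.one_apply,
        map_smul, hff]
      module
  have e₁ := h₁ n
  have e₂ := h₂ n
  rw [hn, map_zero] at e₁
  rw [hn, map_zero, sub_zero] at e₂
  by_cases hμ : μ = 0
  · rw [hμ, sub_zero, one_pow, one_smul] at e₁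
    rw [← e₁, hμ, zero_smul]
  · have hv : f v = v := by
      rcases smul_eq_zero.1 e₂.symm with h | h
      · exact absurd h (pow_ne_zero _ (neg_ne_zero.2 hμ))
      · exact (sub_eq_zero.1 h).symm
    rw [hv] at e₁ ⊢
    rcases smul_eq_zero.1 e₁.symm with h | h
    · rw [← sub_eq_zero.1 (eq_zero_of_pow_eq_zero h), one_smul]
    · rw [h, smul_zero]

lemma maxGenEigenspace_eq_eigenspace {f : Module.End k V} (hf : IsIdempotentElem f) (μ : k) :
    f.maxGenEigenspace μ = f.eigenspace μ :=
  le_antisymm (fun _ hv => Module.End.mem_eigenspace_iff.2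
      (apply_eq_smul_of_mem_maxGenEigenspace hf hv))
    ((f.genEigenspace μ).mono le_top)

lemma iSup_eigenspace_eq_top {f : Module.End k V} (hf : IsIdempotentElem f) :
    ⨆ μ, f.eigenspace μ = ⊤ := by
  refine Submodule.eq_top_iff'.2 fun v => ?_
  have hff (w : V) : f (f w) = f w := LinearMap.congr_fun hf w
  rw [← add_sub_cancel (f v) v]
  refine Submodule.add_mem _ (Submodule.mem_iSup_of_mem 1 ?_) (Submodule.mem_iSup_of_mem 0 ?_)
  · rw [Module.End.mem_eigenspace_iff, hff, one_smul]
  · rw [Module.End.mem_eigenspace_iff, map_sub, hff, sub_self, zero_smul]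

/-- The joint eigenspace of a family of idempotents on which exactly the members of `χ` act as the
identity and the others as zero. -/
noncomputable def peirce {ι : Type*} (f : ι → Module.End k V) (χ : Set ι) : Submodule k V :=
  ⨅ i, (f i).eigenspace (χ.indicator 1 i)

lemma mem_peirce {ι : Type*} {f : ι → Module.End k V} {χ : Set ι} {v : V} :
    v ∈ peirce f χ ↔ ∀ i, f i v = χ.indicator (1 : ι → k) i • v := by
  simp only [peirce, Submodule.mem_iInf, Module.End.mem_eigenspace_iff]

variable {ι : Type*} {f : ι → Module.End k V}

lemma iSupIndep_peirce (hf : ∀ i, IsIdempotentElem (f i)) (hcomm : ∀ i j, Commute (f i) (f j)) :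
    iSupIndep (peirce f) := by
  have h := Module.End.independent_iInf_maxGenEigenspace_of_forall_mapsTo f fun i j μ =>
    Module.End.mapsTo_maxGenEigenspace_of_comm (hcomm j i) μ
  simp only [maxGenEigenspace_eq_eigenspace (hf _)] at h
  refine h.comp (f := fun χ : Set ι => χ.indicator (1 : ι → k)) fun χ χ' heq => ?_
  ext i
  have := congrFun heq i
  by_cases hi : i ∈ χ <;> by_cases hi' : i ∈ χ' <;> simp_all

lemma iSup_peirce [FiniteDimensional k V] (hf : ∀ i, IsIdempotentElem (f i))
    (hcomm : ∀ i j, Commute (f i) (f j)) : ⨆ χ, peirce f χ = ⊤ := by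
  have h := Module.End.iSup_iInf_maxGenEigenspace_eq_top_of_iSup_maxGenEigenspace_eq_top_of_commute
    f (fun i j _ => hcomm i j) fun i => by
      simp only [maxGenEigenspace_eq_eigenspace (hf i), iSup_eigenspace_eq_top (hf i)]
  simp only [maxGenEigenspace_eq_eigenspace (hf _)] at h
  rw [eq_top_iff, ← h]
  refine iSup_le fun c v hv => ?_
  simp only [Submodule.mem_iInf, Module.End.mem_eigenspace_iff] at hv
  by_cases hv0 : v = 0
  · rw [hv0]
    exact Submodule.zero_mem _
  · refine Submodule.mem_iSup_of_mem {i | c i = 1} (mem_peirce.2 fun i => ?_)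
    rw [hv i]
    by_cases hi : c i = 1
    · simp [hi]
    · have h2 : c i • c i • v = c i • v := by
        rw [← hv i, ← map_smul, ← hv i]
        exact LinearMap.congr_fun (hf i) v
      rw [smul_smul] at h2
      have h3 : c i * c i = c i := smul_left_injective k hv0 h2
      have h0 : c i = 0 := by
        by_contra h0
        exact hi (mul_left_cancel₀ h0 (h3.trans (mul_one _).symm))
      simp [h0]

end Idempotents

open PwfRep

variable {k : Type κ} [Field k] {A : Type u} [Category.{v} A] [Preadditive A] [Linear k A]

lemma IsDirectSum.subtype {ι : Type ℓ} {M : PwfRep.{u, v, κ, m} k A}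
    {N : ι → PwfRep.{u, v, κ, m} k A} {inc : ∀ i, N i ⟶ M} (h : IsDirectSum inc) (p : ι → Prop)
    (hp : ∀ i, ¬ p i → IsZero (N i)) : IsDirectSum fun i : Subtype p => inc i := by
  refine of_iSupIndep (fun i => h.injective i) (fun x => (h.iSupIndep_range x).comp
    Subtype.val_injective) fun x => ?_
  rw [eq_top_iff, ← h.iSup_range x]
  refine iSup_le fun i => ?_
  by_cases hi : p i
  · exact le_iSup (fun i : Subtype p => LinearMap.range (app (inc i) x)) ⟨i, hi⟩
  · rintro _ ⟨n, rfl⟩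
    have := isZero_iff.1 (hp i hi) x
    rw [Subsingleton.elim n 0, map_zero]
    exact Submodule.zero_mem _

namespace PwfRep

lemma exists_maximal_commuting_idempotents (R : Type*) [Ring R] :
    ∃ B : Set R, (∀ b ∈ B, IsIdempotentElem b) ∧ (∀ b ∈ B, ∀ c ∈ B, Commute b c) ∧
      ∀ e, IsIdempotentElem e → (∀ b ∈ B, Commute e b) → e ∈ B := by
  obtain ⟨B, ⟨hB, hcomm⟩, hmax⟩ := zorn_subset
    {B : Set R | (∀ b ∈ B, IsIdempotentElem b) ∧ ∀ b ∈ B, ∀ c ∈ B, Commute b c} (by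
      intro c hc hchain
      refine ⟨⋃₀ c, ⟨?_, ?_⟩, fun s hs => Set.subset_sUnion_of_mem hs⟩
      · rintro b ⟨s, hs, hb⟩
        exact (hc hs).1 b hb
      · rintro b ⟨s, hs, hb⟩ b' ⟨s', hs', hb'⟩
        rcases hchain.total hs hs' with h | h
        · exact (hc hs').2 b (h hb) b' hb'
        · exact (hc hs).2 b hb b' (h hb'))
  refine ⟨B, hB, hcomm, fun e he hec => ?_⟩
  refine hmax (y := insert e B) ⟨?_, ?_⟩ (Set.subset_insert e B) (Set.mem_insert e B)
  · rintro b (rfl | hb)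
    exacts [he, hB b hb]
  · rintro b (rfl | hb) c (rfl | hc)
    exacts [Commute.refl _, hec c hc, (hec b hb).symm, hcomm b hb c hc]

/-- The subrepresentation on which exactly the members of `χ` act as the identity and the other
members of `B` as zero. -/
noncomputable def peirceRep {M : PwfRep.{u, v, κ, m} k A} (B : Set (End M)) (χ : Set B) :
    SubRep M where
  carrier x := peirce (fun b : B => app b.1 x) χ
  act_mem a v hv := by
    rw [mem_peirce] at hv ⊢
    intro b
    rw [app_act, hv b, map_smul]

lemma app_incl_peirceRep {M : PwfRep.{u, v, κ, m} k A} {B : Set (End M)} {χ : Set B} (b : B)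
    {x : A} (n : (peirceRep B χ).toRep.space x) :
    app b.1 x (app (peirceRep B χ).incl x n) =
      χ.indicator (1 : B → k) b • app (peirceRep B χ).incl x n :=
  mem_peirce.1 (Subtype.prop (p := fun v => v ∈ (peirceRep B χ).carrier x) n) b

/-- A pointwise finite-dimensional representation is a direct sum of indecomposable
representations. -/
theorem exists_isDirectSum_indecomposable (M : PwfRep.{u, v, κ, m} k A) :
    ∃ (ι : Type (max u m)) (N : ι → PwfRep.{u, v, κ, m} k A) (inc : ∀ i, N i ⟶ M),
      IsDirectSum inc ∧ ∀ i, Indecomposable (N i) := by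
  obtain ⟨B, hB, hcomm, hmax⟩ := exists_maximal_commuting_idempotents (End M)
  let N (χ : Set B) : PwfRep.{u, v, κ, m} k A := (peirceRep B χ).toRep
  let inc (χ : Set B) : N χ ⟶ M := (peirceRep B χ).incl
  have hidem (x : A) (b : B) : IsIdempotentElem (app b.1 x) :=
    congrArg (fun f : End M => app f x) (hB b.1 b.2)
  have hcomm' (x : A) (b c : B) : Commute (app b.1 x) (app c.1 x) :=
    congrArg (fun f : End M => app f x) (hcomm b.1 b.2 c.1 c.2)
  have hrange (x : A) (χ : Set B) : LinearMap.range (app (inc χ) x) =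
      peirce (fun b : B => app b.1 x) χ := Submodule.range_subtype _
  have h : IsDirectSum inc := by
    refine .of_iSupIndep (fun χ x => Subtype.val_injective) (fun x => ?_) fun x => ?_
    · simp only [hrange]
      exact iSupIndep_peirce (hidem x) (hcomm' x)
    · simp only [hrange]
      exact iSup_peirce (hidem x) (hcomm' x)
  refine ⟨{χ // ¬ IsZero (N χ)}, fun χ => N χ, fun χ => inc χ,
    h.subtype _ fun _ => not_not.1, fun χ => ⟨χ.2, fun Y Z i => ?_⟩⟩
  let e₀ : N χ ⟶ N χ := i.hom ≫ biprod.fst ≫ biprod.inl ≫ i.inv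
  let e : M ⟶ M := h.proj χ ≫ e₀ ≫ inc χ
  have hinc : inc χ ≫ e = e₀ ≫ inc χ := by
    simp only [e, reassoc_of% (h.inc_proj χ.1)]
  have hinc' {χ' : Set B} (hne : χ' ≠ χ) : inc χ' ≫ e = 0 := by
    simp only [e, reassoc_of% (h.inc_proj_of_ne hne), zero_comp]
  have he₀ : e₀ ≫ e₀ = e₀ := by simp [e₀]
  have hb (b : B) (χ' : Set B) (x : A) (n) : app b.1 x (app (inc χ') x n) =
    χ'.indicator (1 : B → k) b • app (inc χ') x n := app_incl_peirceRep b n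
  have heB : e ∈ B := by
    refine hmax e ?_ fun b hbB => ?_
    · change e ≫ e = e
      simp only [e, Category.assoc, reassoc_of% (h.inc_proj χ.1), reassoc_of% he₀]
    · refine h.hom_ext fun χ' => PwfRep.hom_ext fun x n => ?_
      change app e x (app b x (app (inc χ') x n)) = app b x (app e x (app (inc χ') x n))
      rw [hb ⟨b, hbB⟩, map_smul]
      by_cases hχ : χ' = χ
      · subst hχ
        rw [← app_comp (inc _) e, hinc, app_comp, hb ⟨b, hbB⟩]
      · rw [← app_comp (inc _) e, hinc' hχ, app_zero, smul_zero, map_zero]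
  have hscalar (x : A) (n : (N χ).space x) :
      app e₀ x n = (χ : Set B).indicator (1 : B → k) ⟨e, heB⟩ • n := by
    apply h.injective χ x
    rw [← app_comp, ← hinc, app_comp, hb ⟨e, heB⟩, map_smul]
  by_cases hχ : (⟨e, heB⟩ : B) ∈ (χ : Set B)
  · right
    have h1 : e₀ = 𝟙 _ := PwfRep.hom_ext fun x n => by
      rw [hscalar, Set.indicator_of_mem hχ, Pi.one_apply, one_smul, app_id]
    rw [IsZero.iff_id_eq_zero]
    have : biprod.inr ≫ i.inv ≫ e₀ ≫ i.hom ≫ biprod.snd = 𝟙 Z := by simp [h1]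
    rw [← this]
    simp [e₀]
  · left
    have h0 : e₀ = 0 := PwfRep.hom_ext fun x n => by
      rw [hscalar, Set.indicator_of_notMem hχ, zero_smul, app_zero]
    rw [IsZero.iff_id_eq_zero]
    have : biprod.inl ≫ i.inv ≫ e₀ ≫ i.hom ≫ biprod.fst = 𝟙 Y := by simp [e₀]
    rw [← this, h0]
    simp

end PwfRep

end ThreadQuiver
namespace ThreadQuiver

open PwfRep

variable {k : Type κ} [Field k] {Q : Type u} [Quiver.{v} Q] {P : Quiver.Total Q → Type w}
  [∀ α, LinearOrder (P α)] {I : CatIdeal k (PathCat k P)}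

lemma IsNoise.of_iso {M N : PwfRep.{_, _, κ, m} k I.Quot} (e : M ≅ N) (h : IsNoise M) :
    IsNoise N := fun a =>
  have := h a
  (spaceEquiv e (toQuot I (.vertex a))).symm.toEquiv.subsingleton

lemma SupportedOn.of_iso {M N : PwfRep.{_, _, κ, m} k I.Quot} (e : M ≅ N) {α : Quiver.Total Q}
    (h : SupportedOn α M) : SupportedOn α N := fun X hX =>
  have := hX
  h X (spaceEquiv e (toQuot I X)).toEquiv.nontrivial

lemma exists_eq_toQuot (x : I.Quot) : ∃ X : Obj P, x = toQuot I X := ⟨x.as, rfl⟩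

lemma SupportedOn.unique {M : PwfRep.{_, _, κ, m} k I.Quot} (hM : ¬ IsZero M)
    {α β : Quiver.Total Q} (hα : SupportedOn α M) (hβ : SupportedOn β M) : α = β := by
  obtain ⟨x, hx⟩ := exists_nontrivial hM
  obtain ⟨X, rfl⟩ := exists_eq_toQuot x
  obtain ⟨p, rfl⟩ := hα X hx
  obtain ⟨q, hq⟩ := hβ _ hx
  exact (Obj.thread.inj hq).1

/-- On a noise representation, the morphisms given by paths act as zero, because they factor
through vertices. -/
lemma IsNoise.act_single {M : PwfRep.{_, _, κ, m} k I.Quot} (hM : IsNoise M) {X Y : Obj P}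
    (p : PathLike X Y) (r : k)
    (hXY : ¬ ∃ α, (∃ x, X = .thread α x) ∧ ∃ y, Y = .thread α y) :
    M.act (I.quotFunctor.map (Finsupp.single p r : Free.of k X ⟶ Free.of k Y)) = 0 := by
  cases p with
  | within h => exact (hXY ⟨_, ⟨_, rfl⟩, _, rfl⟩).elim
  | through p =>
    let a : X ⟶ Obj.vertex (P := P) X.exit := PathLike.through Quiver.Path.nil
    let b : Obj.vertex (P := P) X.exit ⟶ Y := PathLike.through p
    have hab : a ≫ b = PathLike.through p :=
      congrArg PathLike.through (by
        change (Quiver.Path.nil.comp Quiver.Path.nil).comp p = p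
        rw [Quiver.Path.nil_comp, Quiver.Path.nil_comp])
    let a' : Free.of k X ⟶ Free.of k (Obj.vertex (P := P) X.exit) := Finsupp.single a r
    let b' : Free.of k (Obj.vertex (P := P) X.exit) ⟶ Free.of k Y := Finsupp.single b 1
    let c' : Free.of k X ⟶ Free.of k Y := Finsupp.single (PathLike.through p) r
    have hfac : c' = a' ≫ b' := by
      change Finsupp.single (PathLike.through p) r = _
      rw [← hab]
      exact ((Free.single_comp_single k (Obj P) a b r 1).trans (by rw [mul_one])).symm
    refine LinearMap.ext fun v => ?_
    have := hM X.exit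
    have hcomp := congrArg (fun φ => φ.hom.hom v)
      ((congrArg (I.quotFunctor ⋙ M.obj).map hfac).trans ((I.quotFunctor ⋙ M.obj).map_comp _ _))
    refine hcomp.trans ((congrArg _ (Subsingleton.elim (α := M.space (toQuot I (.vertex X.exit)))
      _ 0)).trans ?_)
    exact map_zero (M.act (I.quotFunctor.map b'))

/-- On a noise representation, a morphism acts as zero unless its endpoints lie on the same
thread. -/
lemma IsNoise.act_eq_zero {M : PwfRep.{_, _, κ, m} k I.Quot} (hM : IsNoise M) {X Y : Obj P}
    (f : toQuot I X ⟶ toQuot I Y)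
    (hXY : ¬ ∃ α, (∃ x, X = .thread α x) ∧ ∃ y, Y = .thread α y) : M.act f = 0 := by
  have hadd := M.property.1
  obtain ⟨g, rfl⟩ := (CategoryTheory.Quotient.functor I.rel).map_surjective
    (X := Free.of k X) (Y := Free.of k Y) f
  change M.act (I.quotFunctor.map g) = 0
  induction g using Finsupp.induction_linear with
  | zero =>
    exact congrArg (fun φ : M.obj.obj (toQuot I X) ⟶ M.obj.obj (toQuot I Y) => φ.hom.hom)
      ((I.quotFunctor ⋙ M.obj).map_zero (Free.of k X) (Free.of k Y))
  | add g g' hg hg' =>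
    have : M.act (I.quotFunctor.map (g + g')) =
        M.act (I.quotFunctor.map g) + M.act (I.quotFunctor.map g') :=
      congrArg (fun φ => φ.hom.hom) ((I.quotFunctor ⋙ M.obj).map_add (f := g) (g := g'))
    exact this.trans (by rw [hg, hg', add_zero])
  | single p r =>
    exact hM.act_single p r hXY

open Classical in
/-- The restriction of a noise representation to the objects that satisfy `p`, provided that `p`
does not distinguish the objects of one thread. -/
noncomputable def IsNoise.restrict {M : PwfRep.{_, _, κ, m} k I.Quot} (hM : IsNoise M)
    (p : I.Quot → Prop)
    (hp : ∀ α x y, p (toQuot I (.thread α x)) → p (toQuot I (.thread α y))) : SubRep M where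
  carrier x := if p x then ⊤ else ⊥
  act_mem {x y} a v hv := by
    by_cases hy : p y
    · rw [if_pos hy]
      exact Submodule.mem_top
    · by_cases hx : p x
      · obtain ⟨X, rfl⟩ := exists_eq_toQuot x
        obtain ⟨Y, rfl⟩ := exists_eq_toQuot y
        rw [hM.act_eq_zero a]
        · exact Submodule.zero_mem _
        · rintro ⟨α, ⟨x, rfl⟩, y, rfl⟩
          exact hy (hp α x y hx)
      · rw [if_neg hx, Submodule.mem_bot] at hv
        rw [hv, map_zero]
        exact Submodule.zero_mem _

lemma IsNoise.not_of_restrict_eq_bot {M : PwfRep.{_, _, κ, m} k I.Quot} (hM : IsNoise M)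
    {p : I.Quot → Prop}
    {hp : ∀ α x y, p (toQuot I (.thread α x)) → p (toQuot I (.thread α y))} {x : I.Quot}
    (hx : Nontrivial (M.space x)) (h : (hM.restrict p hp).carrier x = ⊥) : ¬ p x := fun hpx =>
  top_ne_bot ((if_pos hpx).symm.trans h)

lemma IsNoise.exists_supportedOn {M : PwfRep.{_, _, κ, m} k I.Quot} (hM : Indecomposable M)
    (hnoise : IsNoise M) : ∃ α, SupportedOn α M := by
  obtain ⟨x, hx⟩ := exists_nontrivial hM.1
  obtain ⟨X, rfl⟩ := exists_eq_toQuot x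
  cases X with
  | vertex a => exact (not_subsingleton_iff_nontrivial.2 hx (hnoise a)).elim
  | thread α x =>
    refine ⟨α, fun Y hY => by_contra fun hne => ?_⟩
    let p (y : I.Quot) : Prop := ∃ z, y = toQuot I (.thread α z)
    have hthread (β z) (hz : p (toQuot I (.thread β z))) : β = α := by
      obtain ⟨z', hz'⟩ := hz
      exact (Obj.thread.inj (congrArg (fun y : I.Quot => (y.as : Obj P)) hz')).1
    rcases SubRep.eq_bot_or_eq_bot hM
      (hnoise.restrict p fun β z z' hz => by
        obtain rfl := hthread β z hz
        exact ⟨z', rfl⟩)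
      (hnoise.restrict (fun y => ¬ p y) fun β z z' hz hz' => hz (by
        obtain rfl := hthread β z' hz'
        exact ⟨z, rfl⟩))
      (fun y => by
        by_cases hy : p y
        · simp only [IsNoise.restrict, hy, not_true, if_true, if_false]
          exact isCompl_top_bot
        · simp only [IsNoise.restrict, hy, not_false_eq_true, if_true, if_false]
          exact isCompl_bot_top) with h | h
    · exact hnoise.not_of_restrict_eq_bot hx (h _) ⟨x, rfl⟩
    · refine hnoise.not_of_restrict_eq_bot hY (h (toQuot I Y)) fun ⟨z, hz⟩ => ?_
      exact hne ⟨z, congrArg (fun y : I.Quot => (y.as : Obj P)) hz⟩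

lemma IsNoiseFree.not_isNoise {M : PwfRep.{_, _, κ, m} k I.Quot} (hM : Indecomposable M)
    (h : IsNoiseFree M) : ¬ IsNoise M := fun hnoise => by
  let S : SubRep M := ⟨fun _ => ⊤, fun _ _ _ => Submodule.mem_top⟩
  let T : SubRep M := ⟨fun _ => ⊥, fun a v hv => by
    rw [Submodule.mem_bot] at hv ⊢
    rw [hv, map_zero]⟩
  have hS := h S.toRep T.toRep (SubRep.nonempty_iso_biprod S T fun x => isCompl_top_bot)
    fun a => by
      have := hnoise a
      exact inferInstanceAs
        (Subsingleton (⊤ : Submodule k (M.space (toQuot I (.vertex a)))))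
  rw [SubRep.isZero_toRep_iff] at hS
  obtain ⟨x, hx⟩ := exists_nontrivial hM.1
  exact top_ne_bot (hS x)

lemma isNoiseFree_of_not_isNoise {M : PwfRep.{_, _, κ, m} k I.Quot} (hM : Indecomposable M)
    (h : ¬ IsNoise M) : IsNoiseFree M := by
  rintro N N' ⟨e⟩ hN
  refine (hM.2 N N' e).resolve_right fun hN' => h ?_
  have hiso : M ≅ N := e ≪≫ isoOfBijective biprod.fst fun x => by
    have : Subsingleton (N'.space x) := isZero_iff.1 hN' x
    refine Function.bijective_iff_has_inverse.2 ⟨app biprod.inl x, fun z => ?_, fun n => ?_⟩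
    · have : z = app biprod.inl x (app biprod.fst x z) + app biprod.inr x (app biprod.snd x z) := by
        rw [← app_comp, ← app_comp, ← app_add, biprod.total, app_id]
      rw [Subsingleton.elim (app biprod.snd x z) 0, map_zero, add_zero] at this
      exact this.symm
    · rw [← app_comp, biprod.inl_fst, app_id]
  exact hN.of_iso hiso.symm

theorem nonempty_noiseDecomposition (M : PwfRep.{_, _, κ, m} k I.Quot) :
    Nonempty (NoiseDecomposition.{u, v, w, κ, m, max u v w m} M) := by
  obtain ⟨ι, N, inc, h, hN⟩ := exists_isDirectSum_indecomposable M
  let H (α : Quiver.Total Q) := {i // IsNoise (N i) ∧ SupportedOn α (N i)}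
  let f : {i // ¬ IsNoise (N i)} ⊕ (Σ α, H α) → ι := Sum.elim (fun i => i.1) fun p => p.2.1
  have hf : Function.Bijective f := by
    constructor
    · rintro (⟨i, hi⟩ | ⟨α, i, hi, hα⟩) (⟨j, hj⟩ | ⟨β, j, hj, hβ⟩) hij
      · obtain rfl : i = j := hij
        rfl
      · obtain rfl : i = j := hij
        exact (hi hj).elim
      · obtain rfl : i = j := hij
        exact (hj hi).elim
      · obtain rfl : i = j := hij
        obtain rfl := hα.unique (hN i).1 hβ
        rfl
    · intro i
      by_cases hi : IsNoise (N i)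
      · obtain ⟨α, hα⟩ := hi.exists_supportedOn (hN i)
        exact ⟨.inr ⟨α, i, hi, hα⟩, rfl⟩
      · exact ⟨.inl ⟨i, hi⟩, rfl⟩
  exact ⟨{
    Λ := {i // ¬ IsNoise (N i)}
    H := H
    Z := fun i => N i
    V := fun _ i => N i
    indecomposable_Z := fun i => hN i
    noiseFree_Z := fun i => isNoiseFree_of_not_isNoise (hN i) i.2
    indecomposable_V := fun _ i => hN i
    noise_V := fun _ i => i.2.1
    supportedOn_V := fun _ i => i.2.2
    incZ := fun i => inc i
    incV := fun _ i => inc i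
    isDirectSum := h.congr (Equiv.ofBijective f hf)
      (fun p => match p with
        | .inl _ => Iso.refl _
        | .inr _ => Iso.refl _)
      (fun p => match p with
        | .inl _ => (Category.id_comp _).symm
        | .inr _ => (Category.id_comp _).symm) }⟩

namespace NoiseDecomposition

variable {M : PwfRep.{_, _, κ, m} k I.Quot}

/-- The family of all summands of a decomposition. -/
abbrev summand (D : NoiseDecomposition.{u, v, w, κ, m, ℓ} M) :
    D.Λ ⊕ (Σ α, D.H α) → PwfRep.{_, _, κ, m} k I.Quot :=
  Sum.elim D.Z fun p => D.V p.1 p.2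

lemma indecomposable_summand (D : NoiseDecomposition.{u, v, w, κ, m, ℓ} M) (p) :
    Indecomposable (D.summand p) := by
  rcases p with l | ⟨α, η⟩
  exacts [D.indecomposable_Z l, D.indecomposable_V α η]

lemma not_isNoise_Z (D : NoiseDecomposition.{u, v, w, κ, m, ℓ} M) (l : D.Λ) : ¬ IsNoise (D.Z l) :=
  (D.noiseFree_Z l).not_isNoise (D.indecomposable_Z l)

/-- The arrow on which a noise summand is supported, and `none` for a noise free summand. -/
def tag (D : NoiseDecomposition.{u, v, w, κ, m, ℓ} M) :
    D.Λ ⊕ (Σ α, D.H α) → Option (Quiver.Total Q) :=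
  Sum.elim (fun _ => none) fun p => some p.1

lemma tag_eq_of_iso {D : NoiseDecomposition.{u, v, w, κ, m, ℓ} M}
    {D' : NoiseDecomposition.{u, v, w, κ, m, ℓ'} M} {p p'} (e : D.summand p ≅ D'.summand p') :
    D.tag p = D'.tag p' := by
  rcases p with l | ⟨α, η⟩ <;> rcases p' with l' | ⟨β, η'⟩
  · rfl
  · exact (D.not_isNoise_Z l ((D'.noise_V β η').of_iso e.symm)).elim
  · exact (D'.not_isNoise_Z l' ((D.noise_V α η).of_iso e)).elim
  · exact congrArg some (((D.supportedOn_V α η).of_iso e).unique (D'.indecomposable_V β η').1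
      (D'.supportedOn_V β η'))

/-- The noise free summands are the summands without a tag. -/
def equivTagNone (D : NoiseDecomposition.{u, v, w, κ, m, ℓ} M) : D.Λ ≃ {p // D.tag p = none} where
  toFun l := ⟨.inl l, rfl⟩
  invFun p := match p with
    | ⟨.inl l, _⟩ => l
    | ⟨.inr _, h⟩ => (Option.some_ne_none _ h).elim
  left_inv _ := rfl
  right_inv p := match p with
    | ⟨.inl _, _⟩ => rfl
    | ⟨.inr _, h⟩ => (Option.some_ne_none _ h).elim

/-- The noise summands on an arrow are the summands with that tag. -/
noncomputable def equivTagSome (D : NoiseDecomposition.{u, v, w, κ, m, ℓ} M)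
    (α : Quiver.Total Q) : D.H α ≃ {p // D.tag p = some α} :=
  Equiv.ofBijective (fun η => ⟨.inr ⟨α, η⟩, rfl⟩) (by
    constructor
    · intro η η' h
      exact eq_of_heq (Sigma.mk.inj (Sum.inr.inj (congrArg Subtype.val h))).2
    · rintro ⟨l | ⟨β, η⟩, h⟩
      · exact (Option.some_ne_none _ h.symm).elim
      · obtain rfl : β = α := Option.some.inj h
        exact ⟨η, rfl⟩)

theorem exists_equiv (D : NoiseDecomposition.{u, v, w, κ, m, ℓ} M)
    (D' : NoiseDecomposition.{u, v, w, κ, m, ℓ'} M) :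
    (∃ e : D.Λ ≃ D'.Λ, ∀ l, Nonempty (D.Z l ≅ D'.Z (e l))) ∧
      ∀ α, ∃ e : D.H α ≃ D'.H α, ∀ η, Nonempty (D.V α η ≅ D'.V α (e η)) := by
  obtain ⟨e, he⟩ := D.isDirectSum.exists_equiv D'.isDirectSum D.indecomposable_summand
    D'.indecomposable_summand
  have htag (p) : D.tag p = D'.tag (e p) := (he p).elim tag_eq_of_iso
  let eTag (t) : {p // D.tag p = t} ≃ {p // D'.tag p = t} :=
    e.subtypeEquiv fun p => by rw [htag]
  refine ⟨⟨D.equivTagNone.trans ((eTag none).trans D'.equivTagNone.symm), fun l => ?_⟩,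
    fun α => ⟨(D.equivTagSome α).trans ((eTag (some α)).trans (D'.equivTagSome α).symm),
      fun η => ?_⟩⟩
  · obtain ⟨l', hl'⟩ := D'.equivTagNone.surjective (eTag none (D.equivTagNone l))
    simp only [Equiv.trans_apply, ← hl', Equiv.symm_apply_apply]
    have hval : e (.inl l) = .inl l' := congrArg Subtype.val hl'.symm
    have := he (.inl l)
    rwa [hval] at this
  · obtain ⟨η', hη'⟩ := (D'.equivTagSome α).surjective (eTag (some α) (D.equivTagSome α η))
    simp only [Equiv.trans_apply, ← hη', Equiv.symm_apply_apply]
    have hval : e (.inr ⟨α, η⟩) = .inr ⟨α, η'⟩ := congrArg Subtype.val hη'.symm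
    have := he (.inr ⟨α, η⟩)
    rwa [hval] at this

theorem finite_Λ [Finite Q] (D : NoiseDecomposition.{u, v, w, κ, m, ℓ} M) : Finite D.Λ := by
  have hfin (a : Q) : {l | Nontrivial ((D.Z l).space (toQuot I (.vertex a)))}.Finite :=
    Set.Finite.preimage (f := Sum.inl)
      (s := {p | Nontrivial ((D.summand p).space (toQuot I (.vertex a)))})
      Sum.inl_injective.injOn (D.isDirectSum.finite_nontrivial _)
  refine Set.finite_univ_iff.1 ((Set.finite_iUnion hfin).subset fun l _ => ?_)
  have := D.not_isNoise_Z l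
  simp only [IsNoise, not_forall, not_subsingleton_iff_nontrivial] at this
  exact Set.mem_iUnion.2 this

end NoiseDecomposition

end ThreadQuiver

theorem mainTheorem3 {k : Type κ} [Field k] {Q : Type u} [Quiver.{v} Q]
    (P : Quiver.Total Q → Type w) [∀ α, LinearOrder (P α)]
    (I : ThreadQuiver.CatIdeal k (ThreadQuiver.PathCat k P))
    (M : ThreadQuiver.PwfRep.{_, _, κ, m} k I.Quot) :
    -- existence of the decomposition
    Nonempty (ThreadQuiver.NoiseDecomposition.{u, v, w, κ, m, max u v w m} M) ∧
    -- every summand has local endomorphism ring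
    (∀ D : ThreadQuiver.NoiseDecomposition.{u, v, w, κ, m, ℓ} M,
      (∀ l, IsLocalRing (End (D.Z l))) ∧ ∀ α η, IsLocalRing (End (D.V α η))) ∧
    -- uniqueness up to isomorphism
    (∀ (D : ThreadQuiver.NoiseDecomposition.{u, v, w, κ, m, ℓ} M)
      (D' : ThreadQuiver.NoiseDecomposition.{u, v, w, κ, m, ℓ'} M),
      (∃ e : D.Λ ≃ D'.Λ, ∀ l, Nonempty (D.Z l ≅ D'.Z (e l))) ∧
      ∀ α, ∃ e : D.H α ≃ D'.H α, ∀ η, Nonempty (D.V α η ≅ D'.V α (e η))) ∧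
    -- finiteness of the noise free part when `Q` is finite
    (Finite Q → Finite (Quiver.Total Q) →
      ∀ D : ThreadQuiver.NoiseDecomposition.{u, v, w, κ, m, ℓ} M, Finite D.Λ) := by
  exact ⟨ThreadQuiver.nonempty_noiseDecomposition M,
    fun D => ⟨fun l => ThreadQuiver.PwfRep.isLocalRing_end (D.indecomposable_Z l),
      fun α η => ThreadQuiver.PwfRep.isLocalRing_end (D.indecomposable_V α η)⟩,
    fun D D' => D.exists_equiv D', fun _ _ D => D.finite_Λ⟩
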